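/- Let $r>1$ be an irrational real number and let $P_r=\{\lfloor nr\rfloor : n\in\mathbb{Z}\setminus\{0\}\}$. Then multiplication on $\mathbb{Z}$ is not definable in the first-order structure $(\mathbb{Z},+,-,0,1,P_r)$, where $P_r$ interprets a unary predicate symbol; that is, the graph $\{(x,y,z)\in\mathbb{Z}^3 : xy=z\}$ is not defined in this structure by any first-order formula, even with parameters from $\mathbb{Z}$. -/

import Mathlib

namespace BeattyExpansion

/-- The set `P_r` of all integers of the form `⌊n r⌋` with `n` a nonzero integer. -/
def beattySet (r : ℝ) : Set ℤ :=
  {k | ∃ n : ℤ, n ≠ 0 ∧ k = ⌊(n : ℝ) * r⌋}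

/-- Function symbols of `L_P`: those of abelian groups, with a distinguished element. -/
inductive LPFunc : ℕ → Type
  | add : LPFunc 2
  | neg : LPFunc 1
  | zero : LPFunc 0
  | one : LPFunc 0

/-- Relation symbols of `L_P`: one unary predicate symbol `P`. -/
inductive LPRel : ℕ → Type
  | P : LPRel 1

/-- The first-order language `L_P = {+, -, 0, 1, P}`. -/
def LP : FirstOrder.Language where
  Functions := LPFunc
  Relations := LPRel

/-- The `L_P`-structure `(ℤ, +, -, 0, 1, P_r)`. -/
@[reducible] def beattyStructure (r : ℝ) : LP.Structure ℤ where
  funMap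
    | .add, v => v 0 + v 1
    | .neg, v => -v 0
    | .zero, _ => 0
    | .one, _ => 1
  RelMap
    | .P, v => v 0 ∈ beattySet r

end BeattyExpansion

namespace BeattyExpansion

open SignType

/-! Put `a = r⁻¹`. Then `m` lies in `P_r` exactly when the fractional part of `m * a` exceeds `1 -
a`. Since `a` is irrational, `frac a` identifies `ℤ` with the points of the dense group `Γ = ℤ + ℤ
a` in `[0, 1)`, so atomic formulas become sign conditions on affine forms. Adding congruences modulo
`N • Γ` makes this class of conditions stable under projection (`exists_match`), as in quantifier
elimination for dense ordered groups; hence definable sets are `Tame`.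

Multiplication is not tame. For suitable `k ≠ 0` and `y`, every form involving the second coordinate
is nonzero at `(k, y, k * y)`. By density `y` can be moved to some `z ≠ y`, close in fractional part
and congruent, without changing any sign; but `k * z = k * y` forces `z = y`. -/

/-- Affine forms with integer coefficients and real constant term. -/
abbrev AffForm (ι : Type*) := (ι → ℤ) × ℝ

/-- The value of an affine form at a real tuple. -/
def AffForm.eval {ι : Type*} [Fintype ι] (f : AffForm ι) (u : ι → ℝ) : ℝ :=
  ∑ i, (f.1 i : ℝ) * u i + f.2

section Eval

variable {ι : Type*} [Fintype ι]

lemma AffForm.eval_sub (f g : AffForm ι) (u : ι → ℝ) :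
    AffForm.eval (f - g) u = f.eval u - g.eval u := by
  simp only [AffForm.eval, Prod.fst_sub, Prod.snd_sub, Pi.sub_apply, Int.cast_sub, sub_mul,
    Finset.sum_sub_distrib]
  ring

lemma AffForm.eval_zsmul (n : ℤ) (f : AffForm ι) (u : ι → ℝ) :
    AffForm.eval (n • f) u = n * f.eval u := by
  have h : n • f.2 = n * f.2 := zsmul_eq_mul _ _
  simp only [AffForm.eval, Prod.smul_fst, Prod.smul_snd, Pi.smul_apply, smul_eq_mul,
    Int.cast_mul, h, mul_add, Finset.mul_sum, mul_assoc]

end Eval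

/-! ### Back-and-forth over a dense subgroup -/

/-- Two real tuples are indistinguishable with respect to a finite set of affine forms and a
modulus if the forms have equal signs at them and they are congruent modulo `N • Γ`. -/
def Indist {ι : Type*} [Fintype ι] (Γ : AddSubgroup ℝ) (F : Finset (AffForm ι)) (N : ℕ)
    (u v : ι → ℝ) : Prop :=
  (∀ f ∈ F, sign (f.eval u) = sign (f.eval v)) ∧ ∀ i, ∃ γ ∈ Γ, v i - u i = N * γ

section Indist

variable {ι : Type*} [Fintype ι] {Γ : AddSubgroup ℝ}

lemma Indist.symm {F : Finset (AffForm ι)} {N : ℕ} {u v : ι → ℝ} (h : Indist Γ F N u v) :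
    Indist Γ F N v u := by
  refine ⟨fun f hf => (h.1 f hf).symm, fun i => ?_⟩
  obtain ⟨γ, hγ, e⟩ := h.2 i
  exact ⟨-γ, Γ.neg_mem hγ, by linarith⟩

lemma Indist.mono {F G : Finset (AffForm ι)} {N M : ℕ} {u v : ι → ℝ} (h : Indist Γ F N u v)
    (hG : G ⊆ F) (hM : M ∣ N) : Indist Γ G M u v := by
  refine ⟨fun f hf => h.1 f (hG hf), fun i => ?_⟩
  obtain ⟨γ, hγ, e⟩ := h.2 i
  obtain ⟨k, rfl⟩ := hM
  exact ⟨k * γ, by simpa using Γ.nsmul_mem hγ k, by rw [e]; push_cast; ring⟩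

lemma Indist.eval_sub_eval {F : Finset (AffForm ι)} {N : ℕ} {u v : ι → ℝ}
    (h : Indist Γ F N u v) (f : AffForm ι) : ∃ γ ∈ Γ, f.eval v - f.eval u = N * γ := by
  choose γ hγ e using h.2
  refine ⟨∑ i, (f.1 i : ℝ) * γ i, Γ.sum_mem fun i _ => ?_, ?_⟩
  · simpa using Γ.zsmul_mem (hγ i) (f.1 i)
  · simp only [AffForm.eval, Finset.mul_sum, add_sub_add_right_eq_sub, ← Finset.sum_sub_distrib]
    refine Finset.sum_congr rfl fun i _ => ?_
    rw [← mul_sub, e]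
    ring

/-- Every coset of `N • Γ` meets every nonempty open set when `Γ` is dense. -/
lemma exists_mem_add_nsmul (hΓ : Dense (Γ : Set ℝ)) {N : ℕ} (hN : 0 < N) (x : ℝ) {U : Set ℝ}
    (hU : IsOpen U) (hne : U.Nonempty) : ∃ γ ∈ Γ, x + N * γ ∈ U := by
  have hN' : (N : ℝ) ≠ 0 := by positivity
  obtain ⟨w, hw⟩ := hne
  have ho : IsOpen ((fun g : ℝ => x + N * g) ⁻¹' U) := hU.preimage (by fun_prop)
  obtain ⟨γ, h1, h2⟩ := hΓ.exists_mem_open ho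
    ⟨(w - x) / N, by simpa [Set.mem_preimage, mul_div_cancel₀ _ hN'] using hw⟩
  exact ⟨γ, h1, h2⟩

/-- The root in the first variable of an affine form with a distinguished first variable. -/
noncomputable def root (f : ℤ × AffForm ι) (u : ι → ℝ) : ℝ := -f.2.eval u / f.1

lemma sign_eval_eq {f : ℤ × AffForm ι} (hf : f.1 ≠ 0) (u : ι → ℝ) (x : ℝ) :
    sign (f.1 * x + f.2.eval u) = sign (f.1 : ℝ) * sign (x - root f u) := by
  have : (f.1 : ℝ) ≠ 0 := by exact_mod_cast hf
  rw [← sign_mul, root]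
  congr 1
  field_simp
  ring

/-- A form whose sign is that of the difference of two roots. -/
def crossForm (f g : ℤ × AffForm ι) : AffForm ι := (f.1 * g.1) • (f.1 • g.2 - g.1 • f.2)

lemma sign_eval_crossForm {f g : ℤ × AffForm ι} (hf : f.1 ≠ 0) (hg : g.1 ≠ 0) (u : ι → ℝ) :
    sign ((crossForm f g).eval u) = sign (root f u - root g u) := by
  have hf' : (f.1 : ℝ) ≠ 0 := by exact_mod_cast hf
  have hg' : (g.1 : ℝ) ≠ 0 := by exact_mod_cast hg
  -- The outer factor `f.1 * g.1` turns the multiplier into a square, so the signs of the leading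
  -- coefficients do not matter.
  have : (crossForm f g).eval u = ((f.1 : ℝ) * g.1) ^ 2 * (root f u - root g u) := by
    rw [crossForm, AffForm.eval_zsmul, AffForm.eval_sub, AffForm.eval_zsmul, AffForm.eval_zsmul,
      root, root]
    push_cast
    field_simp
    ring
  rw [this, sign_mul, sign_pos (by positivity), one_mul]

/-- The back-and-forth step: an element over `u` can be matched over `v`. -/
lemma exists_match (hΓ : Dense (Γ : Set ℝ)) (F : Finset (ℤ × AffForm ι)) {N : ℕ} (hN : 0 < N) :
    ∃ F' : Finset (AffForm ι), ∃ N' : ℕ, 0 < N' ∧ N ∣ N' ∧ ∀ u v : ι → ℝ, Indist Γ F' N' u v →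
      ∀ x ∈ Γ, ∃ y ∈ Γ, (∃ γ ∈ Γ, y - x = N * γ) ∧
        ∀ f ∈ F, sign (f.1 * x + f.2.eval u) = sign (f.1 * y + f.2.eval v) := by
  classical
  set G := F.filter (fun f => f.1 ≠ 0) with hG
  -- The cross forms record the order of the roots; the product in the modulus pays for dividing by
  -- a leading coefficient when a root is formed.
  refine ⟨F.image Prod.snd ∪ (F ×ˢ F).image (fun p => crossForm p.1 p.2),
    N * ∏ f ∈ G, f.1.natAbs, ?_, dvd_mul_right _ _, fun u v huv x hx => ?_⟩
  · refine Nat.mul_pos hN (Finset.prod_pos fun f hf => ?_)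
    exact Int.natAbs_pos.2 (Finset.mem_filter.1 hf).2
  suffices H : ∃ y ∈ Γ, (∃ γ ∈ Γ, y - x = N * γ) ∧
      ∀ f ∈ G, sign (x - root f u) = sign (y - root f v) by
    obtain ⟨y, hy, hxy, h⟩ := H
    refine ⟨y, hy, hxy, fun f hf => ?_⟩
    by_cases h0 : f.1 = 0
    · simpa [h0] using huv.1 f.2 (Finset.mem_union_left _ (Finset.mem_image_of_mem _ hf))
    · rw [sign_eval_eq h0, sign_eval_eq h0, h f (Finset.mem_filter.2 ⟨hf, h0⟩)]
  have key : ∀ f ∈ G, ∀ g ∈ G, sign (root f u - root g u) = sign (root f v - root g v) := by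
    intro f hf g hg
    obtain ⟨hf, hf0⟩ := Finset.mem_filter.1 hf
    obtain ⟨hg, hg0⟩ := Finset.mem_filter.1 hg
    rw [← sign_eval_crossForm hf0 hg0, ← sign_eval_crossForm hf0 hg0]
    exact huv.1 _ (Finset.mem_union_right _
      (Finset.mem_image_of_mem (fun p : _ × _ => crossForm p.1 p.2)
        (Finset.mk_mem_product hf hg)))
  -- If `x` is a root, the same root over `v` is the match; otherwise `x` lies in an open gap
  -- between roots, and density fills the corresponding gap over `v`.
  by_cases hroot : ∃ f ∈ G, x = root f u
  · obtain ⟨f, hf, rfl⟩ := hroot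
    obtain ⟨γ, hγ, e⟩ : ∃ γ ∈ Γ, root f v - root f u = N * γ := by
      obtain ⟨δ, hδ, e⟩ := huv.eval_sub_eval f.2
      have hf0 : (f.1 : ℝ) ≠ 0 := by exact_mod_cast (Finset.mem_filter.1 hf).2
      obtain ⟨k, hk⟩ : f.1 ∣ ((∏ f ∈ G, f.1.natAbs : ℕ) : ℤ) :=
        Int.natAbs_dvd.1 (Int.natCast_dvd_natCast.2 (Finset.dvd_prod_of_mem _ hf))
      have hk' : ((∏ f ∈ G, f.1.natAbs : ℕ) : ℝ) = f.1 * k := by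
        rw [← Int.cast_natCast, hk, Int.cast_mul]
      refine ⟨((-k : ℤ) : ℝ) * δ, by simpa using Γ.zsmul_mem hδ (-k), ?_⟩
      rw [Nat.cast_mul, hk'] at e
      rw [root, root, ← sub_div, div_eq_iff hf0]
      push_cast
      linarith
    refine ⟨root f v, ?_, ⟨γ, hγ, e⟩, fun g hg => key f hf g hg⟩
    rw [sub_eq_iff_eq_add.1 e]
    exact Γ.add_mem (by simpa using Γ.nsmul_mem hγ N) hx
  · push Not at hroot
    set lo := (G.filter (fun f => root f u < x)).image (fun f => root f v)
    set hi := (G.filter (fun f => x < root f u)).image (fun f => root f v)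
    have hlohi : ∀ a ∈ lo, ∀ b ∈ hi, a < b := by
      intro a ha b hb
      obtain ⟨f, hf, rfl⟩ := Finset.mem_image.1 ha
      obtain ⟨g, hg, rfl⟩ := Finset.mem_image.1 hb
      obtain ⟨hf, hfx⟩ := Finset.mem_filter.1 hf
      obtain ⟨hg, hgx⟩ := Finset.mem_filter.1 hg
      have := key f hf g hg
      rw [sign_neg (sub_neg.2 (hfx.trans hgx)), eq_comm, sign_eq_neg_one_iff] at this
      exact sub_neg.1 this
    have hopen : IsOpen ((⋂ a ∈ lo, Set.Ioi a) ∩ ⋂ b ∈ hi, Set.Iio b) :=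
      (isOpen_biInter_finset fun _ _ => isOpen_Ioi).inter
        (isOpen_biInter_finset fun _ _ => isOpen_Iio)
    obtain ⟨m, hm1, hm2⟩ := Order.exists_between_finsets lo hi hlohi
    obtain ⟨γ, hγ, hy1, hy2⟩ := exists_mem_add_nsmul hΓ hN x hopen ⟨m, by simpa using hm1,
      by simpa using hm2⟩
    rw [Set.mem_iInter₂] at hy1 hy2
    refine ⟨x + N * γ, Γ.add_mem hx (by simpa using Γ.nsmul_mem hγ N), ⟨γ, hγ, by ring⟩,
      fun f hf => ?_⟩
    rcases lt_or_gt_of_ne (hroot f hf) with h | h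
    · have := hy2 _ (Finset.mem_image_of_mem (fun f => root f v)
        (Finset.mem_filter.2 ⟨hf, h⟩))
      rw [sign_neg (sub_neg.2 h), sign_neg (sub_neg.2 this)]
    · have := hy1 _ (Finset.mem_image_of_mem (fun f => root f v)
        (Finset.mem_filter.2 ⟨hf, h⟩))
      rw [sign_pos (sub_pos.2 h), sign_pos (sub_pos.2 this)]

end Indist

/-! ### Fractional parts and the group `ℤ + ℤ a` -/

/-- The fractional part of `m * a`. -/
noncomputable def frac (a : ℝ) (m : ℤ) : ℝ := Int.fract ((m : ℝ) * a)

/-- The additive group `ℤ + ℤ a`. -/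
def pairGroup (a : ℝ) : AddSubgroup ℝ := AddSubgroup.closure {1, a}

lemma mem_pairGroup {a x : ℝ} : x ∈ pairGroup a ↔ ∃ m n : ℤ, (m : ℝ) + n * a = x := by
  simp [pairGroup, AddSubgroup.mem_closure_pair]

lemma dense_pairGroup {a : ℝ} (ha : Irrational a) : Dense (pairGroup a : Set ℝ) := by
  rw [pairGroup, dense_addSubgroupClosure_pair_iff, one_div]
  exact ha.inv

lemma frac_mem_pairGroup (a : ℝ) (m : ℤ) : frac a m ∈ pairGroup a :=
  mem_pairGroup.2 ⟨-⌊(m : ℝ) * a⌋, m, by rw [frac, Int.fract]; push_cast; ring⟩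

lemma exists_frac_eq {a y : ℝ} (hy : y ∈ pairGroup a) (h0 : 0 ≤ y) (h1 : y < 1) :
    ∃ m : ℤ, frac a m = y := by
  obtain ⟨k, m, rfl⟩ := mem_pairGroup.1 hy
  refine ⟨m, ?_⟩
  rw [← Int.fract_eq_self.2 ⟨h0, h1⟩, frac, Int.fract_intCast_add]

lemma frac_injective {a : ℝ} (ha : Irrational a) : Function.Injective (frac a) := by
  intro m n h
  by_contra hmn
  obtain ⟨z, hz⟩ := Int.fract_eq_fract.1 h
  have h0 : m - n ≠ 0 := sub_ne_zero.2 hmn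
  have := (ha.intCast_mul h0).ne_int z
  apply this
  push_cast
  linarith

/-! ### Tame sets and their closure properties -/

/-- A set of integer tuples is tame if membership only depends on the signs of finitely many
affine forms at the fractional parts and on the congruence class of the fractional parts. -/
def Tame {ι : Type*} [Fintype ι] (a : ℝ) (A : Set (ι → ℤ)) : Prop :=
  ∃ (F : Finset (AffForm ι)) (N : ℕ), 0 < N ∧ ∀ x y : ι → ℤ,
    Indist (pairGroup a) F N (frac a ∘ x) (frac a ∘ y) → x ∈ A → y ∈ A

section Tame

variable {ι : Type*} [Fintype ι] {a : ℝ}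

lemma Tame.compl {A : Set (ι → ℤ)} (h : Tame a A) : Tame a Aᶜ := by
  obtain ⟨F, N, hN, h⟩ := h
  exact ⟨F, N, hN, fun x y hxy hx hy => hx (h y x hxy.symm hy)⟩

lemma Tame.union {A B : Set (ι → ℤ)} (hA : Tame a A) (hB : Tame a B) : Tame a (A ∪ B) := by
  classical
  obtain ⟨F, N, hN, hA⟩ := hA
  obtain ⟨G, M, hM, hB⟩ := hB
  refine ⟨F ∪ G, N * M, Nat.mul_pos hN hM, fun x y hxy hx => ?_⟩
  rcases hx with hx | hx
  · exact Or.inl (hA x y (hxy.mono Finset.subset_union_left (dvd_mul_right _ _)) hx)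
  · exact Or.inr (hB x y (hxy.mono Finset.subset_union_right (dvd_mul_left _ _)) hx)

variable {β : Type*} {n : ℕ}

/-- Extension of a tuple by one entry in the `Fin` part of the index type. -/
def extend {R : Type*} (w : β ⊕ Fin n → R) (c : R) : β ⊕ Fin (n + 1) → R :=
  Sum.elim (w ∘ Sum.inl) (Fin.snoc (α := fun _ => R) (w ∘ Sum.inr) c)

/-- Separation of the coefficient of the last variable of an affine form. -/
def splitLast (f : AffForm (β ⊕ Fin (n + 1))) : ℤ × AffForm (β ⊕ Fin n) :=
  (f.1 (Sum.inr (Fin.last n)), (f.1 ∘ Sum.map id Fin.castSucc, f.2))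

lemma eval_extend [Fintype β] (f : AffForm (β ⊕ Fin (n + 1))) (w : β ⊕ Fin n → ℝ) (c : ℝ) :
    f.eval (extend w c) = (splitLast f).1 * c + (splitLast f).2.eval w := by
  simp only [AffForm.eval, extend, splitLast, Fintype.sum_sum_type, Fin.sum_univ_castSucc,
    Sum.elim_inl, Sum.elim_inr, Fin.snoc_castSucc, Fin.snoc_last, Function.comp_apply,
    Sum.map_inl, Sum.map_inr, id_eq]
  ring

lemma comp_extend (g : ℤ → ℝ) (w : β ⊕ Fin n → ℤ) (c : ℤ) :
    g ∘ extend w c = extend (g ∘ w) (g c) := by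
  funext i
  rcases i with i | i
  · rfl
  · refine Fin.lastCases ?_ (fun i => ?_) i <;> simp [extend]

/-- Tame sets are closed under projection. -/
lemma Tame.exists_extend [Fintype β] (ha : Irrational a) {A : Set (β ⊕ Fin (n + 1) → ℤ)}
    (hA : Tame a A) :
    Tame a {w : β ⊕ Fin n → ℤ | ∃ c, extend w c ∈ A} := by
  classical
  obtain ⟨F, N, hN, hA⟩ := hA
  -- The extra forms `x` and `x - 1` keep the match in `[0, 1)`, so that it is again a fractional
  -- part.
  obtain ⟨F', N', hN', hdvd, h⟩ := exists_match (dense_pairGroup ha)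
    (F.image splitLast ∪ {(1, (0, 0)), (1, (0, -1))}) hN
  refine ⟨F', N', hN', fun u v huv => ?_⟩
  rintro ⟨c, hc⟩
  obtain ⟨y, hy, hcy, hs⟩ := h _ _ huv (frac a c) (frac_mem_pairGroup a c)
  have h0 := hs (1, (0, 0)) (by simp)
  have h1 := hs (1, (0, -1)) (by simp)
  simp only [AffForm.eval, Pi.zero_apply, Int.cast_zero, zero_mul, Finset.sum_const_zero,
    Int.cast_one, one_mul, zero_add, add_zero] at h0 h1
  have hy0 : 0 ≤ y := by
    have : 0 ≤ frac a c := Int.fract_nonneg _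
    rwa [← sign_nonneg_iff, ← h0, sign_nonneg_iff]
  have hy1 : y < 1 := by
    have : frac a c < 1 := Int.fract_lt_one _
    rw [sign_neg (by linarith), eq_comm, sign_eq_neg_one_iff] at h1
    linarith
  obtain ⟨d, rfl⟩ := exists_frac_eq hy hy0 hy1
  refine ⟨d, hA _ _ ⟨fun f hf => ?_, fun i => ?_⟩ hc⟩
  · rw [comp_extend, comp_extend, eval_extend, eval_extend]
    exact hs _ (Finset.mem_union_left _ (Finset.mem_image_of_mem _ hf))
  · rw [comp_extend, comp_extend]
    have hm := (huv.mono subset_rfl hdvd).2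
    rcases i with i | i
    · exact hm (Sum.inl i)
    · refine Fin.lastCases ?_ (fun i => ?_) i
      · simpa [extend] using hcy
      · simpa [extend] using hm (Sum.inr i)

/-- The sign of `fract L - s` at a tuple in the unit cube is determined by finitely many signs
of affine forms. -/
lemma exists_forms_fract (f : AffForm ι) (s : ℝ) : ∃ F : Finset (AffForm ι), ∀ u v : ι → ℝ,
    (∀ i, 0 ≤ u i ∧ u i < 1) → (∀ g ∈ F, sign (g.eval u) = sign (g.eval v)) →
      sign (Int.fract (f.eval u) - s) = sign (Int.fract (f.eval v) - s) := by
  classical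
  -- `K` bounds the form on the unit cube, so only finitely many floors occur there.
  set K : ℝ := ∑ i, |(f.1 i : ℝ)| + |f.2| with hK
  set I := Finset.Icc ⌊-K⌋ ⌊K⌋
  refine ⟨I.image (fun k : ℤ => (f.1, f.2 - (k : ℝ))) ∪
    I.image (fun k : ℤ => (f.1, f.2 - (k : ℝ) - 1)) ∪
    I.image (fun k : ℤ => (f.1, f.2 - (k : ℝ) - s)), fun u v hu h => ?_⟩
  have hval : ∀ (c : ℝ) (w : ι → ℝ), AffForm.eval (f.1, f.2 - c) w = f.eval w - c := by
    intro c w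
    simp only [AffForm.eval]
    ring
  have hle : |f.eval u| ≤ K := by
    refine (abs_add_le _ _).trans (add_le_add_left ((Finset.abs_sum_le_sum_abs _ _).trans
      (Finset.sum_le_sum fun i _ => ?_)) _)
    rw [abs_mul, abs_of_nonneg (hu i).1]
    exact mul_le_of_le_one_right (abs_nonneg _) (hu i).2.le
  set k := ⌊f.eval u⌋ with hk
  have hkI : k ∈ I := Finset.mem_Icc.2
    ⟨Int.floor_le_floor (abs_le.1 hle).1, Int.floor_le_floor (abs_le.1 hle).2⟩
  have e0 := h (f.1, f.2 - k) (Finset.mem_union_left _ (Finset.mem_union_left _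
    (Finset.mem_image_of_mem (fun k : ℤ => (f.1, f.2 - (k : ℝ))) hkI)))
  have e1 := h (f.1, f.2 - k - 1) (Finset.mem_union_left _ (Finset.mem_union_right _
    (Finset.mem_image_of_mem (fun k : ℤ => (f.1, f.2 - (k : ℝ) - 1)) hkI)))
  have e2 := h (f.1, f.2 - k - s) (Finset.mem_union_right _
    (Finset.mem_image_of_mem (fun k : ℤ => (f.1, f.2 - (k : ℝ) - s)) hkI))
  rw [sub_sub, hval, hval] at e1 e2
  rw [hval, hval] at e0
  have hkv : ⌊f.eval v⌋ = k := by
    rw [Int.floor_eq_iff]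
    constructor
    · rw [← sub_nonneg, ← sign_nonneg_iff, ← e0, sign_nonneg_iff, sub_nonneg]
      exact Int.floor_le _
    · rw [← sub_neg, ← sign_eq_neg_one_iff, ← e1, sign_eq_neg_one_iff, sub_neg]
      exact Int.lt_floor_add_one _
  rw [Int.fract, Int.fract, hkv, ← hk, sub_sub, sub_sub, e2]

/-- Modulo `1`, multiplying a linear combination by `a` gives the affine form evaluated at the
fractional parts, so `exists_forms_fract` applies. -/
lemma Tame.of_sign_frac (m : ι → ℤ) (c : ℤ) (s : ℝ) (S : Set SignType) :
    Tame a {w : ι → ℤ | sign (frac a (∑ i, m i * w i + c) - s) ∈ S} := by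
  obtain ⟨F, hF⟩ := exists_forms_fract (m, c * a) s
  refine ⟨F, 1, one_pos, fun x y hxy hx => ?_⟩
  have key : ∀ w : ι → ℤ, frac a (∑ i, m i * w i + c) =
      Int.fract (AffForm.eval (m, c * a) (frac a ∘ w)) := by
    intro w
    rw [frac, Int.fract_eq_fract]
    refine ⟨∑ i, m i * ⌊(w i : ℝ) * a⌋, ?_⟩
    simp only [AffForm.eval, Function.comp_apply, frac, Int.fract]
    push_cast
    rw [add_mul, Finset.sum_mul, add_sub_add_right_eq_sub, ← Finset.sum_sub_distrib]
    exact Finset.sum_congr rfl fun i _ => by ring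
  have := hF _ _ (fun i => ⟨Int.fract_nonneg _, Int.fract_lt_one _⟩) hxy.1
  rw [Set.mem_ofPred_eq, key] at hx ⊢
  rwa [← this]

lemma Tame.of_linear_eq_zero (ha : Irrational a) (m : ι → ℤ) (c : ℤ) :
    Tame a {w : ι → ℤ | ∑ i, m i * w i + c = 0} := by
  convert Tame.of_sign_frac (a := a) m c 0 {0} using 3 with w
  rw [sub_zero, Set.mem_singleton_iff, sign_eq_zero_iff]
  have : frac a 0 = 0 := by simp [frac]
  rw [← this, (frac_injective ha).eq_iff]

end Tame

/-! ### The Beatty set as an arc -/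

/-- The Beatty set as the preimage of an arc under `m ↦ m / r` modulo `1`. -/
lemma mem_beattySet_iff {r : ℝ} (hr : 1 < r) (hirr : Irrational r) (m : ℤ) :
    m ∈ beattySet r ↔ 1 - r⁻¹ < frac r⁻¹ m := by
  have hr0 : 0 < r := by linarith
  have hmul : r⁻¹ * r = 1 := inv_mul_cancel₀ hr0.ne'
  have hlt : r⁻¹ < 1 := inv_lt_one_of_one_lt₀ hr
  constructor
  · rintro ⟨n, hn, hm⟩
    obtain ⟨h1, h2⟩ := Int.floor_eq_iff.1 hm.symm
    have h1' : (m : ℝ) < n * r := lt_of_le_of_ne h1 ((hirr.intCast_mul hn).ne_int m).symm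
    have h3 : (m : ℝ) * r⁻¹ < n := by rwa [← div_eq_mul_inv, div_lt_iff₀ hr0]
    have h4 : (n : ℝ) < m * r⁻¹ + r⁻¹ := by
      rw [← add_one_mul, ← div_eq_mul_inv, lt_div_iff₀ hr0]
      exact h2
    have hfl : ⌊(m : ℝ) * r⁻¹⌋ = n - 1 := by
      rw [Int.floor_eq_iff]
      push_cast
      constructor <;> linarith
    rw [frac, Int.fract, hfl]
    push_cast
    linarith
  · intro h
    rw [frac, Int.fract] at h
    set k := ⌊(m : ℝ) * r⁻¹⌋
    have h1 : (m : ℝ) * r⁻¹ < k + 1 := Int.lt_floor_add_one _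
    have h2 : (m : ℝ) < (k + 1) * r := by rwa [← div_lt_iff₀ hr0, div_eq_mul_inv]
    have h3 : (k + 1) * r < (m : ℝ) + 1 := by
      rw [← lt_div_iff₀ hr0, div_eq_mul_inv]
      linarith
    refine ⟨k + 1, fun h0 => ?_, ?_⟩
    -- The excluded index `0` would put the integer `m` strictly between `-1` and `0`.
    · have h0' : (k : ℝ) + 1 = 0 := by exact_mod_cast h0
      rw [h0', zero_mul] at h2 h3
      have h4 : m < 0 := by exact_mod_cast h2
      have h5 : 0 < m + 1 := by exact_mod_cast h3
      omega
    · rw [eq_comm, Int.floor_eq_iff]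
      push_cast
      exact ⟨h2.le, h3⟩

lemma Tame.of_linear_mem_beattySet {ι : Type*} [Fintype ι] {r : ℝ} (hr : 1 < r)
    (hirr : Irrational r) (m : ι → ℤ) (c : ℤ) :
    Tame r⁻¹ {w : ι → ℤ | ∑ i, m i * w i + c ∈ beattySet r} := by
  convert Tame.of_sign_frac (a := r⁻¹) m c (1 - r⁻¹) {1} using 3 with w
  rw [mem_beattySet_iff hr hirr, Set.mem_singleton_iff, sign_eq_one_iff, sub_pos]

open Topology FirstOrder

/-! ### Multiplication is not tame -/

/-- The graph of multiplication is not tame. -/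
lemma not_tame_mul {a : ℝ} (ha : Irrational a) :
    ¬ Tame a {w : Fin 3 ⊕ Fin 0 → ℤ | w (Sum.inl 0) * w (Sum.inl 1) = w (Sum.inl 2)} := by
  rintro ⟨F, N, hN, h⟩
  set G := F.filter (fun f => f.1 (Sum.inl 1) ≠ 0)
  -- Avoiding these `k` keeps each form of `G` nonconstant in `s` along the lines `t = k * s - j`.
  have hfin : (⋃ f ∈ G, {k : ℤ | f.1 (Sum.inl 1) + f.1 (Sum.inl 2) * k = 0}).Finite := by
    refine Set.Finite.biUnion G.finite_toSet fun f hf => Set.Subsingleton.finite ?_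
    intro k hk l hl
    rw [Set.mem_ofPred_eq] at hk hl
    have hf1 : f.1 (Sum.inl 1) ≠ 0 := (Finset.mem_filter.1 hf).2
    have hf2 : f.1 (Sum.inl 2) ≠ 0 := fun h0 => hf1 (by simpa [h0] using hk)
    exact mul_left_cancel₀ hf2 (by linarith)
  obtain ⟨k, hk⟩ := (hfin.union (Set.finite_singleton 0)).exists_notMem
  simp only [Set.mem_union, Set.mem_iUnion, Set.mem_ofPred_eq, Set.mem_singleton_iff, not_or,
    not_exists] at hk
  obtain ⟨hkG, hk0⟩ := hk
  set g : AffForm (Fin 3 ⊕ Fin 0) → ℝ → ℝ → ℝ := fun f s t =>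
    f.1 (Sum.inl 0) * frac a k + f.1 (Sum.inl 1) * s + f.1 (Sum.inl 2) * t + f.2 with hg
  -- Here `frac a (k * y) = k * frac a y - j` with `|j| ≤ |k|`, and each `j` leaves one zero of `f`.
  have hfin2 : (⋃ f ∈ G, {y : ℤ | g f (frac a y) (frac a (k * y)) = 0}).Finite := by
    refine Set.Finite.biUnion G.finite_toSet fun f hf => ?_
    have hne : (f.1 (Sum.inl 1) : ℝ) + f.1 (Sum.inl 2) * k ≠ 0 := by
      exact_mod_cast hkG f hf
    refine (((Set.finite_Icc (-|k|) |k|).image fun j : ℤ =>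
      (f.1 (Sum.inl 2) * j - f.2 - f.1 (Sum.inl 0) * frac a k) /
        ((f.1 (Sum.inl 1) : ℝ) + f.1 (Sum.inl 2) * k)).preimage
          (frac_injective ha).injOn).subset fun y hy => ?_
    have h0 : 0 ≤ frac a y := Int.fract_nonneg _
    have h1 : frac a y < 1 := Int.fract_lt_one _
    have hky : frac a (k * y) = k * frac a y - ⌊k * frac a y⌋ := by
      rw [← Int.fract, frac, Int.fract_eq_fract]
      exact ⟨k * ⌊(y : ℝ) * a⌋, by rw [frac, Int.fract]; push_cast; ring⟩
    have habs : |(k : ℝ) * frac a y| ≤ |(k : ℝ)| := by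
      rw [abs_mul, abs_of_nonneg h0]
      exact mul_le_of_le_one_right (abs_nonneg _) h1.le
    refine ⟨⌊k * frac a y⌋, ⟨?_, ?_⟩, ?_⟩
    · rw [Int.le_floor]
      push_cast
      exact (abs_le.1 habs).1
    · have h2 := (Int.floor_le (k * frac a y)).trans (abs_le.1 habs).2
      exact_mod_cast h2
    · have hy' : g f (frac a y) (frac a (k * y)) = 0 := hy
      simp only [hg] at hy'
      rw [hky] at hy'
      simp only
      rw [div_eq_iff hne]
      linarith
  obtain ⟨y, hy⟩ := (hfin2.union (Set.finite_singleton 0)).exists_notMem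
  simp only [Set.mem_union, Set.mem_iUnion, Set.mem_ofPred_eq, Set.mem_singleton_iff, not_or,
    not_exists] at hy
  obtain ⟨hyG, hy0⟩ := hy
  set t := frac a (k * y)
  have hpos : 0 < frac a y := by
    refine lt_of_le_of_ne (Int.fract_nonneg _) fun h0 => hy0 (frac_injective ha ?_)
    simpa [frac] using h0.symm
  have hev : ∀ᶠ s in 𝓝 (frac a y), (0 < s ∧ s < 1) ∧
      ∀ f ∈ F, sign (g f (frac a y) t) = sign (g f s t) := by
    refine Filter.Eventually.and ((eventually_gt_nhds hpos).and
      (eventually_lt_nhds (Int.fract_lt_one _))) ((Filter.eventually_all_finset F).2 fun f hf => ?_)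
    by_cases hf0 : f.1 (Sum.inl 1) = 0
    · exact Filter.Eventually.of_forall fun s => by simp only [hg, hf0, Int.cast_zero, zero_mul]
    · have hc : ContinuousAt (fun s => sign (g f s t)) (frac a y) :=
        ContinuousAt.comp (f := fun s => g f s t)
          (continuousAt_sign_of_ne_zero (hyG f (Finset.mem_filter.2 ⟨hf, hf0⟩)))
          (by simp only [hg]; fun_prop)
      filter_upwards [hc.eventually_mem (IsOpen.mem_nhds (isOpen_discrete {sign (g f (frac a y) t)})
        rfl)] with s hs
      exact (Set.mem_singleton_iff.1 hs).symm
  obtain ⟨V, hV, hVo, hyV⟩ := eventually_nhds_iff.1 hev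
  obtain ⟨γ, hγ, hs, hsne⟩ := exists_mem_add_nsmul (dense_pairGroup ha) hN (frac a y)
    (hVo.inter isOpen_compl_singleton)
    ((dense_compl_singleton (frac a y)).inter_open_nonempty V hVo ⟨_, hyV⟩)
  obtain ⟨⟨hs0, hs1⟩, hsF⟩ := hV _ hs
  obtain ⟨z, hz⟩ := exists_frac_eq ((pairGroup a).add_mem (frac_mem_pairGroup a y)
    (by simpa using (pairGroup a).nsmul_mem hγ N)) hs0.le hs1
  rw [← hz] at hsF hsne
  have heval : ∀ (f : AffForm (Fin 3 ⊕ Fin 0)) (s : ℤ),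
      f.eval (frac a ∘ Sum.elim ![k, s, k * y] Fin.elim0) = g f (frac a s) t := by
    intro f s
    simp [AffForm.eval, Fin.sum_univ_three, hg, t]
  have hmem := h (Sum.elim ![k, y, k * y] Fin.elim0) (Sum.elim ![k, z, k * y] Fin.elim0)
    ⟨fun f hf => by rw [heval, heval]; exact hsF f hf, fun i => ?_⟩ (by simp)
  · have hzy : z = y := by simpa [hk0] using hmem
    exact hsne (by rw [hzy]; rfl)
  · have h0 : ∀ x : ℝ, ∃ γ ∈ pairGroup a, x - x = N * γ := fun x =>
      ⟨0, (pairGroup a).zero_mem, by ring⟩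
    rcases i with i | i
    · fin_cases i
      · exact h0 _
      · exact ⟨γ, hγ, by simp [hz]⟩
      · exact h0 _
    · exact i.elim0

/-! ### Definable sets are tame, by induction on formulas -/

section Formulas

variable {r : ℝ} {β : Type} [Fintype β] {n : ℕ}

/-- Terms define affine functions. -/
lemma exists_realize_eq {ι : Type} [Fintype ι] (t : (LP[[(Set.univ : Set ℤ)]]).Term ι) :
    letI : LP.Structure ℤ := beattyStructure r
    ∃ (m : ι → ℤ) (c : ℤ), ∀ w : ι → ℤ, t.realize w = ∑ i, m i * w i + c := by
  classical
  let _ : LP.Structure ℤ := beattyStructure r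
  induction t with
  | var i => exact ⟨Pi.single i 1, 0, fun w => by simp [Pi.single_apply]⟩
  | @func l f ts ih =>
    choose m c ih using ih
    rcases f with f | f
    · cases f with
      | add =>
        refine ⟨m 0 + m 1, c 0 + c 1, fun w => ?_⟩
        have : Language.Term.realize w (Language.Term.func (Sum.inl LPFunc.add) ts) =
          (ts 0).realize w + (ts 1).realize w := rfl
        refine this.trans ?_
        rw [ih, ih]
        simp only [Pi.add_apply, add_mul, Finset.sum_add_distrib]
        ring
      | neg =>
        refine ⟨-m 0, -c 0, fun w => ?_⟩
        have : Language.Term.realize w (Language.Term.func (Sum.inl LPFunc.neg) ts) =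
          -(ts 0).realize w := rfl
        refine this.trans ?_
        rw [ih]
        simp only [Pi.neg_apply, neg_mul, Finset.sum_neg_distrib]
        ring
      | zero => exact ⟨0, 0, fun w => (rfl : _ = (0 : ℤ)).trans (by simp)⟩
      | one => exact ⟨0, 1, fun w => (rfl : _ = (1 : ℤ)).trans (by simp)⟩
    -- Parameters enter only as constant symbols.
    · match l, f with
      | 0, f => exact ⟨0, (f : (Set.univ : Set ℤ)), fun w =>
          (rfl : _ = (((f : (Set.univ : Set ℤ)) : ℤ))).trans (by simp)⟩
      | l + 1, f => exact isEmptyElim f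

/-- Definable sets of `(ℤ, +, -, 0, 1, P_r)` are tame. -/
lemma tame_realize (hr : 1 < r) (hirr : Irrational r)
    (φ : (LP[[(Set.univ : Set ℤ)]]).BoundedFormula β n) :
    letI : LP.Structure ℤ := beattyStructure r
    Tame r⁻¹ {w : β ⊕ Fin n → ℤ | φ.Realize (w ∘ Sum.inl) (w ∘ Sum.inr)} := by
  let _ : LP.Structure ℤ := beattyStructure r
  induction φ with
  | falsum => exact ⟨∅, 1, one_pos, fun _ _ _ hx => hx⟩
  | equal t₁ t₂ =>
    obtain ⟨m₁, c₁, h₁⟩ := exists_realize_eq (r := r) t₁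
    obtain ⟨m₂, c₂, h₂⟩ := exists_realize_eq (r := r) t₂
    convert Tame.of_linear_eq_zero hirr.inv (m₁ - m₂) (c₁ - c₂) using 3 with w
    rw [Language.BoundedFormula.Realize, Sum.elim_comp_inl_inr, h₁, h₂, ← sub_eq_zero]
    simp only [Pi.sub_apply, sub_mul, Finset.sum_sub_distrib]
    rw [add_sub_add_comm]
  | rel R ts =>
    rcases R with R | R
    · cases R
      obtain ⟨m, c, h⟩ := exists_realize_eq (r := r) (ts 0)
      convert Tame.of_linear_mem_beattySet hr hirr m c using 3 with w
      rw [← h, ← Sum.elim_comp_inl_inr w]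
      rfl
    · exact isEmptyElim R
  | imp φ ψ ihφ ihψ =>
    convert ihφ.compl.union ihψ using 1
    ext w
    simp [imp_iff_not_or]
  | all φ ih =>
    convert (Tame.exists_extend hirr.inv ih.compl).compl using 1
    ext w
    simp [extend, Function.comp_def]

end Formulas

end BeattyExpansion

theorem mainTheorem7 (r : ℝ) (hr : 1 < r) (hirr : Irrational r) :
    letI : BeattyExpansion.LP.Structure ℤ := BeattyExpansion.beattyStructure r
    ¬ (Set.univ : Set ℤ).Definable BeattyExpansion.LP
        {v : Fin 3 → ℤ | v 0 * v 1 = v 2} := by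
  let _ : BeattyExpansion.LP.Structure ℤ := BeattyExpansion.beattyStructure r
  rintro ⟨φ, hφ⟩
  apply BeattyExpansion.not_tame_mul hirr.inv
  convert BeattyExpansion.tame_realize hr hirr φ using 3 with w
  have h : w ∘ Sum.inl ∈ {v : Fin 3 → ℤ | v 0 * v 1 = v 2} ↔ φ.Realize (w ∘ Sum.inl) := by
    rw [hφ]
    rfl
  rw [Set.mem_ofPred_eq] at h
  exact h.trans (iff_of_eq (congrArg (FirstOrder.Language.BoundedFormula.Realize φ (w ∘ Sum.inl))
    (Subsingleton.elim _ _)))
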